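/- Let $\Lambda$ be a nontrivial finite distributive lattice (with least element $\bot$ and greatest element $\top$) and let $X$ be a finite set with $|X| \geq 4$. Let $\Lambda^{X\times X}$ be the monoid of $\Lambda$-generalized correspondences on $X$, that is, the set of all functions $X\times X\to\Lambda$ with the product $$(RS)(x,z)=\bigvee_{y\in X} R(x,y)\wedge S(y,z) \qquad (x,z\in X),$$ whose identity is the function equal to $\top$ on the diagonal and to $\bot$ elsewhere. Then for every field $k$ the monoid algebra $k\Lambda^{X\times X}$ has infinite representation type, that is, there are infinitely many isomorphism classes of indecomposable left $k\Lambda^{X\times X}$-modules that are finite-dimensional over $k$. -/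

import Mathlib

/-- A `Λ`-generalized correspondence on `X`: a function `X × X → Λ`. -/
def GenCorrespondence (Λ X : Type*) : Type _ := X × X → Λ

namespace GenCorrespondence

@[ext]
theorem ext {Λ X : Type*} {R S : GenCorrespondence Λ X} (h : ∀ x z, R (x, z) = S (x, z)) :
    R = S :=
  funext fun p => h p.1 p.2

/-- The product `(RS)(x, z) = ⋁ y, R (x, y) ⊓ S (y, z)`. -/
instance {Λ X : Type*} [DistribLattice Λ] [BoundedOrder Λ] [Fintype X] :
    Mul (GenCorrespondence Λ X) where
  mul R S := fun p => Finset.univ.sup fun y => R (p.1, y) ⊓ S (y, p.2)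

/-- The identity: `⊤` on the diagonal, `⊥` elsewhere. -/
instance {Λ X : Type*} [DistribLattice Λ] [BoundedOrder Λ] [DecidableEq X] :
    One (GenCorrespondence Λ X) where
  one := fun p => if p.1 = p.2 then ⊤ else ⊥

theorem mul_apply {Λ X : Type*} [DistribLattice Λ] [BoundedOrder Λ] [Fintype X]
    (R S : GenCorrespondence Λ X) (x z : X) :
    (R * S) (x, z) = Finset.univ.sup fun y => R (x, y) ⊓ S (y, z) := rfl

theorem one_apply {Λ X : Type*} [DistribLattice Λ] [BoundedOrder Λ] [DecidableEq X]
    (x z : X) :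
    (1 : GenCorrespondence Λ X) (x, z) = if x = z then ⊤ else ⊥ := rfl

/-- The monoid `Λ^{X × X}` of `Λ`-generalized correspondences on `X`. -/
instance {Λ X : Type*} [DistribLattice Λ] [BoundedOrder Λ] [Fintype X] [DecidableEq X] :
    Monoid (GenCorrespondence Λ X) where
  mul_assoc R S T := by
    ext x z
    simp only [mul_apply, Finset.sup_inf_distrib_right, Finset.sup_inf_distrib_left]
    rw [Finset.sup_comm]
    simp only [inf_assoc]
  one_mul R := by
    ext x z
    rw [mul_apply]
    apply le_antisymm
    · refine Finset.sup_le fun y _ => ?_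
      rw [one_apply]
      split_ifs with h
      · simp [h]
      · simp
    · refine le_trans ?_ (Finset.le_sup (Finset.mem_univ x))
      simp [one_apply]
  mul_one R := by
    ext x z
    rw [mul_apply]
    apply le_antisymm
    · refine Finset.sup_le fun y _ => ?_
      rw [one_apply]
      split_ifs with h
      · simp [h]
      · simp
    · refine le_trans ?_ (Finset.le_sup (Finset.mem_univ z))
      simp [one_apply]

end GenCorrespondence

universe u w

/-- The isomorphism classes of the left `A`-modules that are indecomposable and
finite-dimensional over `k` (acting through `algebraMap k A`). The modules are taken in the
universe of `k`; this loses nothing, since a finite-dimensional module is isomorphic to one whose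
underlying vector space is `k ^ n`. -/
def indecomposableClasses (k : Type u) (A : Type w) [Field k] [Ring A] [Algebra k A] :
    Set (Quotient (CategoryTheory.isIsomorphicSetoid (ModuleCat.{u} A))) :=
  {c | ∃ M : ModuleCat.{u} A,
    CategoryTheory.Indecomposable M ∧
    FiniteDimensional k ((ModuleCat.restrictScalars (algebraMap k A)).obj M) ∧
    Quotient.mk _ M = c}

/-- A `k`-algebra has finite representation type if it has only finitely many finite-dimensional
indecomposable left modules up to isomorphism. -/
def HasFiniteRepresentationType (k : Type u) (A : Type w) [Field k] [Ring A] [Algebra k A] :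
    Prop :=
  (indecomposableClasses k A).Finite

/-- A `k`-algebra has infinite representation type if it does not have finite representation
type. -/
def HasInfiniteRepresentationType (k : Type u) (A : Type w) [Field k] [Ring A] [Algebra k A] :
    Prop :=
  ¬ HasFiniteRepresentationType k A

/-! A sup-prime `a` in `Λ` gives a surjective homomorphism `R ↦ (a ≤ R ·)` onto the monoid of
Boolean relations, and inflation along it preserves endomorphisms of modules. So it suffices to
build indecomposable representations of unbounded dimension for relations on at least four points.

Let `P` be the permutation representation, extended by `0` to the other relations; it is
multiplicative because factors of a permutation are permutations. The relations `starRel o σ` are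
closed under multiplication by permutations on either side, and each of their factorizations has a
permutation factor. Hence a map `D` supported on them and equivariant on both sides satisfies `D (m
m') = D m * P m' + P m * D m'`, so the block matrices `[[P, 0], [D, P]]` form a representation.

Over a commutative ring `R` with an element `t`, let `D` send `starRel x 1` to the diagonal matrix
`D_x` with `1` at `x` and `t` elsewhere. For `R = k[X]/(X^(n+1))` and `t = X`, an idempotent
endomorphism acts on both diagonal blocks by one idempotent of `R`, which is `0` or `1`, so the
module is indecomposable. Its dimension `2|X|(n+1)` separates the isomorphism classes. -/

namespace GenCorrespondence

/-! ### Boolean relations: permutations and the prime relations -/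

section Relations

variable {ι : Type*}

/-- The graph of a permutation, as a relation. -/
def permRel (σ : Equiv.Perm ι) : GenCorrespondence Prop ι := fun p => σ p.1 = p.2

/-- The relation `x ↦ N (σ x)`, where `N o` is the complement of `o`, and `N y = {o, y}` for
`y ≠ o`. -/
def starRel (o : ι) (σ : Equiv.Perm ι) : GenCorrespondence Prop ι := fun p =>
  (σ p.1 = o ∧ p.2 ≠ o) ∨ (σ p.1 ≠ o ∧ (p.2 = o ∨ p.2 = σ p.1))

theorem permRel_apply (σ : Equiv.Perm ι) (x y : ι) : permRel σ (x, y) ↔ σ x = y := Iff.rfl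

theorem starRel_apply (o : ι) (σ : Equiv.Perm ι) (x y : ι) :
    starRel o σ (x, y) ↔ (σ x = o ∧ y ≠ o) ∨ (σ x ≠ o ∧ (y = o ∨ y = σ x)) := Iff.rfl

theorem permRel_ne_starRel [Nontrivial ι] (σ τ : Equiv.Perm ι) (o : ι) :
    permRel σ ≠ starRel o τ := fun h => by
  obtain ⟨a, ha⟩ := exists_ne o
  have key : ∀ y, permRel σ (τ.symm a, y) ↔ starRel o τ (τ.symm a, y) := fun y => by rw [h]
  have h1 := (key o).2 (by simp [starRel_apply, ha])
  have h2 := (key a).2 (by simp [starRel_apply, ha])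
  exact ha (h2.symm.trans h1)

theorem permRel_refl [DecidableEq ι] : permRel (Equiv.refl ι) = 1 := by
  ext x z
  rw [one_apply]
  by_cases h : x = z <;> simp [h, permRel_apply]

variable [Fintype ι]

theorem rel_mul_apply (R S : GenCorrespondence Prop ι) (x z : ι) :
    (R * S) (x, z) ↔ ∃ y, R (x, y) ∧ S (y, z) := by
  rw [mul_apply]
  simp [Finset.sup_eq_iSup]

theorem permRel_mul_apply (σ : Equiv.Perm ι) (R : GenCorrespondence Prop ι) (x z : ι) :
    (permRel σ * R) (x, z) ↔ R (σ x, z) := by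
  simp [rel_mul_apply, permRel_apply]

theorem mul_permRel_apply (σ : Equiv.Perm ι) (R : GenCorrespondence Prop ι) (x z : ι) :
    (R * permRel σ) (x, z) ↔ R (x, σ.symm z) := by
  simp only [rel_mul_apply, permRel_apply]
  constructor
  · rintro ⟨y, h, rfl⟩
    simpa using h
  · intro h
    exact ⟨_, h, by simp⟩

theorem permRel_mul_permRel (σ τ : Equiv.Perm ι) :
    permRel σ * permRel τ = permRel (σ.trans τ) := by
  ext x z
  simp [permRel_mul_apply, permRel_apply]

theorem permRel_mul_starRel (o : ι) (σ τ : Equiv.Perm ι) :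
    permRel τ * starRel o σ = starRel o (τ.trans σ) := by
  ext x z
  simp [permRel_mul_apply, starRel_apply]

theorem starRel_mul_permRel (o : ι) (σ τ : Equiv.Perm ι) :
    starRel o σ * permRel τ = starRel (τ o) (σ.trans τ) := by
  ext x z
  simp [mul_permRel_apply, starRel_apply, Equiv.symm_apply_eq]

/-- Choosing an intermediate point between each `x` and `σ x` gives an injective, hence bijective,
map. An extra pair in either factor would produce an extra pair in the product. -/
theorem exists_eq_permRel_of_mul_eq_permRel {R T : GenCorrespondence Prop ι} {σ : Equiv.Perm ι}
    (h : R * T = permRel σ) : (∃ τ, R = permRel τ) ∧ ∃ τ, T = permRel τ := by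
  have key : ∀ x z, (∃ y, R (x, y) ∧ T (y, z)) ↔ σ x = z := fun x z => by
    rw [← rel_mul_apply, h, permRel_apply]
  choose y hR hT using fun x => (key x (σ x)).2 rfl
  have hinj : Function.Injective y := fun a b hab =>
    σ.injective ((key a (σ b)).1 ⟨y a, hR a, hab ▸ hT b⟩)
  let e : Equiv.Perm ι := Equiv.ofBijective y (Finite.injective_iff_bijective.1 hinj)
  refine ⟨⟨e, ?_⟩, e.symm.trans σ, ?_⟩
  · ext x z
    obtain ⟨x', rfl⟩ := e.surjective z
    rw [permRel_apply]
    refine ⟨fun hx => ?_, fun hx => ?_⟩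
    · rw [σ.injective ((key x (σ x')).1 ⟨_, hx, hT x'⟩)]
    · exact hx ▸ hR x
  · ext x z
    obtain ⟨x', rfl⟩ := e.surjective x
    rw [permRel_apply]
    simp only [Equiv.trans_apply, Equiv.symm_apply_apply]
    refine ⟨fun hx => ?_, fun hx => ?_⟩
    · exact (key _ _).1 ⟨_, hR x', hx⟩
    · exact hx ▸ hT x'

variable [DecidableEq ι]

theorem permRel_symm_mul_cancel (σ : Equiv.Perm ι) (R : GenCorrespondence Prop ι) :
    permRel σ.symm * (permRel σ * R) = R := by
  rw [← mul_assoc, permRel_mul_permRel, Equiv.symm_trans_self, permRel_refl, one_mul]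

theorem mul_permRel_symm_cancel (σ : Equiv.Perm ι) (R : GenCorrespondence Prop ι) :
    R * permRel σ * permRel σ.symm = R := by
  rw [mul_assoc, permRel_mul_permRel, Equiv.self_trans_symm, permRel_refl, mul_one]

/-- The relation `starRel o (Equiv.refl ι)` is prime: it is a product of two relations only if one of them is
a permutation. -/
theorem exists_eq_permRel_of_mul_eq_starRel_refl (hι : 4 ≤ Fintype.card ι)
    {R T : GenCorrespondence Prop ι} {o : ι}
    (h : R * T = starRel o (Equiv.refl ι)) : (∃ τ, R = permRel τ) ∨ ∃ τ, T = permRel τ := by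
  have key : ∀ x z, (∃ y, R (x, y) ∧ T (y, z)) ↔ (x = o ∧ z ≠ o) ∨ (x ≠ o ∧ (z = o ∨ z = x)) :=
    fun x z => by rw [← rel_mul_apply, h, starRel_apply]; rfl
  by_cases hA : ∀ i, i ≠ o → ∃ y, R (i, y) ∧ T (y, i) ∧ T (y, o)
  -- Here `T` has the row `{o, i}` at `f i` for each `i ≠ o`. Row `o` of the product omits `o`, so
  -- it must use a further point `p`, and by counting these points are all of `ι`. Each row of `T`
  -- then fits inside only one row of the product.
  · left
    choose! f hR hT hTo using hA
    have hrow : ∀ i, i ≠ o → ∀ z, T (f i, z) → z = o ∨ z = i := fun i hi z hz => by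
      simpa [hi] using (key i z).1 ⟨_, hR i hi, hz⟩
    have hinj : ∀ i, i ≠ o → ∀ j, j ≠ o → f i = f j → i = j := fun i hi j hj hij => by
      have := hrow j hj i (hij ▸ hT i hi)
      tauto
    have hexo : ∀ j, j ≠ o → ∃ y, R (o, y) ∧ T (y, j) ∧ ∀ i, i ≠ o → y ≠ f i := fun j hj => by
      obtain ⟨y, hy1, hy2⟩ := (key o j).2 (by simp [hj])
      refine ⟨y, hy1, hy2, fun i hi hyi => ?_⟩
      simpa using (key o o).1 ⟨y, hy1, hyi ▸ hTo i hi⟩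
    have hthird : ∀ x, ∃ j, j ≠ o ∧ j ≠ x := fun x => by
      by_contra! hno
      have hsub : (Finset.univ : Finset ι) ⊆ {o, x} := fun j _ => by
        by_cases hj : j = o
        · simp [hj]
        · simp [hno j hj]
      have h1 := Finset.card_le_card hsub
      rw [Finset.card_univ] at h1
      have h2 := Finset.card_le_two (a := o) (b := x)
      omega
    obtain ⟨j₀, hj₀, -⟩ := hthird o
    obtain ⟨p, hp1, -, hp3⟩ := hexo j₀ hj₀
    have hg : Function.Injective fun i => if i = o then p else f i := by
      intro i j hij
      by_cases hi : i = o <;> by_cases hj : j = o <;> simp only [hi, hj, if_true, if_false] at hij ⊢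
      · exact absurd hij (hp3 j hj)
      · exact absurd hij.symm (hp3 i hi)
      · exact hinj i hi j hj hij
    let e : Equiv.Perm ι := Equiv.ofBijective _ (Finite.injective_iff_bijective.1 hg)
    have heo : e o = p := if_pos rfl
    have hef : ∀ i, i ≠ o → e i = f i := fun i hi => if_neg hi
    have hpT : ∀ j, j ≠ o → T (p, j) := fun j hj => by
      obtain ⟨q, -, hq2, hq3⟩ := hexo j hj
      obtain ⟨i, rfl⟩ := e.surjective q
      by_cases hi : i = o
      · rwa [hi, heo] at hq2
      · exact absurd (hef i hi) (hq3 i hi)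
    refine ⟨e, ?_⟩
    ext x z
    obtain ⟨i, rfl⟩ := e.surjective z
    rw [permRel_apply, e.apply_eq_iff_eq]
    constructor
    · intro hx
      by_contra hne
      by_cases hi : i = o
      · subst hi
        obtain ⟨j, hj1, hj2⟩ := hthird x
        have := (key x j).1 ⟨_, hx, heo ▸ hpT j hj1⟩
        tauto
      · rw [hef i hi] at hx
        have h1 := (key x o).1 ⟨_, hx, hTo i hi⟩
        have h2 := (key x i).1 ⟨_, hx, hT i hi⟩
        tauto
    · rintro rfl
      by_cases hi : x = o
      · rw [hi, heo]
        exact hp1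
      · rw [hef x hi]
        exact hR x hi
  -- Now row `i₀` of the product is covered only by splitting it, so `T` has the row `{o}` at some
  -- `p`. The rows at `f i` contain `i` and lie in `{o, i}`; they exhaust `T`, and covering row `o`
  -- without `o` forces them to be singletons.
  · right
    push Not at hA
    obtain ⟨i₀, hi₀, hA⟩ := hA
    obtain ⟨p, hp1, hp2⟩ := (key i₀ o).2 (by simp [hi₀])
    have hp : ∀ z, T (p, z) → z = o := fun z hz => by
      have := (key i₀ z).1 ⟨p, hp1, hz⟩
      simp only [hi₀, false_and, false_or, not_false_eq_true, true_and, ne_eq] at this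
      rcases this with h | rfl
      · exact h
      · exact absurd hp2 (hA p hp1 hz)
    have hf : ∀ i, ∃ y, (i = o → y = p) ∧ (i ≠ o → R (i, y)) ∧ T (y, i) := fun i => by
      by_cases hi : i = o
      · exact ⟨p, fun _ => rfl, fun h => absurd hi h, hi ▸ hp2⟩
      · obtain ⟨y, hy1, hy2⟩ := (key i i).2 (by simp [hi])
        exact ⟨y, fun h => absurd h hi, fun _ => hy1, hy2⟩
    choose f hfo hR hT using hf
    have hrow : ∀ i j, T (f i, j) → j = o ∨ j = i := fun i j hj => by
      by_cases hi : i = o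
      · exact Or.inl (hp j (hfo i hi ▸ hj))
      · simpa [hi] using (key i j).1 ⟨_, hR i hi, hj⟩
    have hinj : Function.Injective f := fun i j hij => by
      rcases hrow j i (hij ▸ hT i) with h1 | h1
      · rcases hrow i j (hij ▸ hT j) with h2 | h2
        · exact h1.trans h2.symm
        · exact h2.symm
      · exact h1
    let e : Equiv.Perm ι := Equiv.ofBijective f (Finite.injective_iff_bijective.1 hinj)
    have hno : ∀ j, j ≠ o → ¬ T (f j, o) := fun j hj hjo => by
      obtain ⟨y, hy1, hy2⟩ := (key o j).2 (by simp [hj])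
      obtain ⟨i, rfl⟩ := e.surjective y
      have : j = i := (hrow i j hy2).resolve_left hj
      subst this
      simpa using (key o o).1 ⟨_, hy1, hjo⟩
    refine ⟨e.symm, ?_⟩
    ext x z
    obtain ⟨i, rfl⟩ := e.surjective x
    rw [permRel_apply, Equiv.symm_apply_apply]
    refine ⟨fun hz => ?_, fun hz => hz ▸ hT i⟩
    rcases hrow i z hz with rfl | h1
    · by_contra hne
      exact hno i hne hz
    · exact h1.symm

theorem exists_eq_permRel_of_mul_eq_starRel (hι : 4 ≤ Fintype.card ι)
    {R T : GenCorrespondence Prop ι} {o : ι} {σ : Equiv.Perm ι} (h : R * T = starRel o σ) :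
    (∃ τ, R = permRel τ) ∨ ∃ τ, T = permRel τ := by
  have h' : (permRel σ.symm * R) * T = starRel o (Equiv.refl ι) := by
    rw [mul_assoc, h, permRel_mul_starRel, Equiv.symm_trans_self]
  refine (exists_eq_permRel_of_mul_eq_starRel_refl hι h').imp_left fun ⟨τ, hτ⟩ => ⟨σ.trans τ, ?_⟩
  rw [← permRel_mul_permRel, ← hτ, ← mul_assoc, permRel_mul_permRel, Equiv.self_trans_symm,
    permRel_refl, one_mul]

/-- With four points, the complement of `o` has at least three elements, whereas every other row has
two. So the large row is recognizable, its missing point is `o`, and the remaining rows `{o, σ x}`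
determine `σ`. -/
theorem starRel_injective (hι : 4 ≤ Fintype.card ι) {o o' : ι} {σ τ : Equiv.Perm ι}
    (h : starRel o σ = starRel o' τ) : o = o' ∧ σ = τ := by
  have key : ∀ x y, ((σ x = o ∧ y ≠ o) ∨ (σ x ≠ o ∧ (y = o ∨ y = σ x))) ↔
      ((τ x = o' ∧ y ≠ o') ∨ (τ x ≠ o' ∧ (y = o' ∨ y = τ x))) := fun x y => by
    rw [← starRel_apply, h, starRel_apply]
  have hrow : ∀ x, σ x = o → τ x = o' := fun x hx => by
    by_contra hne
    have hsub : (Finset.univ.erase o) ⊆ {o', τ x} := fun y hy => by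
      have := (key x y).1 (Or.inl ⟨hx, Finset.ne_of_mem_erase hy⟩)
      simpa [hne] using this
    have h1 := Finset.card_le_card hsub
    rw [Finset.card_erase_of_mem (Finset.mem_univ o), Finset.card_univ] at h1
    have h2 := Finset.card_le_two (a := o') (b := τ x)
    omega
  have ho : o = o' := by
    have h1 := key (σ.symm o) o
    have h2 := hrow (σ.symm o) (by simp)
    simpa [h2] using h1
  subst ho
  refine ⟨rfl, Equiv.ext fun x => ?_⟩
  by_cases hx : σ x = o
  · rw [hx, hrow x hx]
  · have h1 := (key x (σ x)).1 (by simp [hx])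
    rcases h1 with ⟨h1, -⟩ | ⟨-, h1 | h1⟩
    · have h2 := key x o
      simp [h1, hx] at h2
    · exact absurd h1 hx
    · exact h1

end Relations

end GenCorrespondence

namespace GenCorrespondence

/-! ### The square-zero extension and its idempotent endomorphisms -/

section Representation

variable {ι R : Type*} [CommRing R]

open Classical in
/-- The matrix of a relation that is a permutation, and `0` for other relations. -/
noncomputable def permPart (R : Type*) [CommRing R] (m : GenCorrespondence Prop ι) :
    Matrix ι ι R :=
  fun x y => if (∃ σ, m = permRel σ) ∧ m (x, y) then 1 else 0

open Classical in
/-- The matrix that sends `starRel o σ` to the permutation matrix of `σ`, with all columns but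
`o` scaled by `t`, and all other relations to `0`. -/
noncomputable def starPart (t : R) (m : GenCorrespondence Prop ι) : Matrix ι ι R :=
  fun x y =>
    if ∃ σ, m = starRel y σ ∧ σ x = y then 1
    else if ∃ o σ, m = starRel o σ ∧ σ x = y then t else 0

theorem permPart_permRel [DecidableEq ι] (σ : Equiv.Perm ι) (x y : ι) :
    permPart R (permRel σ) x y = if σ x = y then 1 else 0 := by
  simp [permPart, permRel_apply]

theorem permPart_eq_zero {m : GenCorrespondence Prop ι} (h : ¬ ∃ σ, m = permRel σ) :
    permPart R m = 0 := by
  ext x y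
  simp only [permPart, h, false_and, if_false, Matrix.zero_apply]

theorem starPart_eq_zero (t : R) {m : GenCorrespondence Prop ι}
    (h : ¬ ∃ o σ, m = starRel o σ) : starPart t m = 0 := by
  ext x y
  have h1 : ¬ ∃ σ, m = starRel y σ ∧ σ x = y := fun ⟨σ, hσ, _⟩ => h ⟨y, σ, hσ⟩
  have h2 : ¬ ∃ o σ, m = starRel o σ ∧ σ x = y := fun ⟨o, σ, hσ, _⟩ => h ⟨o, σ, hσ⟩
  simp only [starPart, h1, h2, if_false, Matrix.zero_apply]

/-- The square-zero extension of the permutation representation by `starPart t`. -/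
noncomputable def starMatrix (t : R) (m : GenCorrespondence Prop ι) :
    Matrix (ι ⊕ ι) (ι ⊕ ι) R :=
  Matrix.fromBlocks (permPart R m) 0 (starPart t m) (permPart R m)

variable [Fintype ι]

theorem starPart_permRel (hι : 4 ≤ Fintype.card ι) (t : R) (σ : Equiv.Perm ι) :
    starPart t (permRel σ) = 0 := by
  have : Nontrivial ι := Fintype.one_lt_card_iff_nontrivial.1 (by omega)
  exact starPart_eq_zero t fun ⟨o, τ, h⟩ => permRel_ne_starRel σ τ o h

theorem starMatrix_starRel_mulVec_inl (hι : 4 ≤ Fintype.card ι) (t : R) (x i : ι)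
    (v : ι ⊕ ι → R) : (starMatrix t (starRel x (Equiv.refl ι))).mulVec v (Sum.inl i) = 0 := by
  have : Nontrivial ι := Fintype.one_lt_card_iff_nontrivial.1 (by omega)
  rw [starMatrix, permPart_eq_zero fun ⟨σ, h⟩ => permRel_ne_starRel _ _ _ h.symm]
  simp [Matrix.fromBlocks_mulVec]

variable [DecidableEq ι]

theorem starPart_starRel (hι : 4 ≤ Fintype.card ι) (t : R) (o : ι) (σ : Equiv.Perm ι) (x y : ι) :
    starPart t (starRel o σ) x y = if σ x = y then (if y = o then 1 else t) else 0 := by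
  have h1 : (∃ τ, starRel o σ = starRel y τ ∧ τ x = y) ↔ y = o ∧ σ x = y := by
    constructor
    · rintro ⟨τ, h, hx⟩
      obtain ⟨rfl, rfl⟩ := starRel_injective hι h
      exact ⟨rfl, hx⟩
    · rintro ⟨rfl, hx⟩
      exact ⟨σ, rfl, hx⟩
  have h2 : (∃ o' τ, starRel o σ = starRel o' τ ∧ τ x = y) ↔ σ x = y := by
    constructor
    · rintro ⟨o', τ, h, hx⟩
      obtain ⟨rfl, rfl⟩ := starRel_injective hι h
      exact hx
    · exact fun hx => ⟨o, σ, rfl, hx⟩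
  simp only [starPart, h1, h2]
  split_ifs <;> tauto

theorem permPart_mul (m m' : GenCorrespondence Prop ι) :
    permPart R (m * m') = permPart R m * permPart R m' := by
  by_cases h : (∃ σ, m = permRel σ) ∧ ∃ σ, m' = permRel σ
  · obtain ⟨⟨σ, rfl⟩, τ, rfl⟩ := h
    ext x z
    simp only [permRel_mul_permRel, permPart_permRel, Matrix.mul_apply, Equiv.trans_apply]
    rw [Finset.sum_eq_single (σ x) (fun y _ hy => by simp [hy.symm]) (by simp)]
    simp
    rfl
  · rw [permPart_eq_zero fun ⟨σ, hσ⟩ => h (exists_eq_permRel_of_mul_eq_permRel hσ)]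
    by_cases h1 : ∃ σ, m = permRel σ
    · rw [permPart_eq_zero (m := m') fun h2 => h ⟨h1, h2⟩, mul_zero]
    · rw [permPart_eq_zero h1, zero_mul]

theorem starPart_permRel_mul (hι : 4 ≤ Fintype.card ι) (t : R) (τ : Equiv.Perm ι)
    (m : GenCorrespondence Prop ι) :
    starPart t (permRel τ * m) = permPart R (permRel τ) * starPart t m := by
  by_cases h : ∃ o σ, m = starRel o σ
  · obtain ⟨o, σ, rfl⟩ := h
    ext x z
    simp only [permRel_mul_starRel, starPart_starRel hι, permPart_permRel, Matrix.mul_apply,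
      Equiv.trans_apply]
    rw [Finset.sum_eq_single (τ x) (fun y _ hy => by simp [hy.symm]) (by simp)]
    simp
    rfl
  · rw [starPart_eq_zero t h, mul_zero, starPart_eq_zero]
    rintro ⟨o, σ, hσ⟩
    exact h ⟨o, _, by rw [← permRel_symm_mul_cancel τ m, hσ, permRel_mul_starRel]⟩

theorem starPart_mul_permRel (hι : 4 ≤ Fintype.card ι) (t : R) (τ : Equiv.Perm ι)
    (m : GenCorrespondence Prop ι) :
    starPart t (m * permRel τ) = starPart t m * permPart R (permRel τ) := by
  by_cases h : ∃ o σ, m = starRel o σ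
  · obtain ⟨o, σ, rfl⟩ := h
    ext x z
    simp only [starRel_mul_permRel, starPart_starRel hι, permPart_permRel, Matrix.mul_apply,
      Equiv.trans_apply]
    rw [Finset.sum_eq_single (σ x) (fun y _ hy => by simp [hy.symm]) (by simp)]
    by_cases hz : τ (σ x) = z
    · subst hz
      simp
    · simp [hz]
  · rw [starPart_eq_zero t h, zero_mul, starPart_eq_zero]
    rintro ⟨o, σ, hσ⟩
    exact h ⟨_, _, by rw [← mul_permRel_symm_cancel τ m, hσ, starRel_mul_permRel]⟩

/-- If neither factor is a permutation, primeness keeps the product from being a star relation, and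
both sides vanish. Otherwise this is equivariance. -/
theorem starPart_mul (hι : 4 ≤ Fintype.card ι) (t : R) (m m' : GenCorrespondence Prop ι) :
    starPart t (m * m') = starPart t m * permPart R m' + permPart R m * starPart t m' := by
  by_cases h : ∃ σ, m = permRel σ
  · obtain ⟨σ, rfl⟩ := h
    rw [starPart_permRel_mul hι, starPart_permRel hι, zero_mul, zero_add]
  · rw [permPart_eq_zero h, zero_mul, add_zero]
    by_cases h' : ∃ σ, m' = permRel σ
    · obtain ⟨σ, rfl⟩ := h'
      rw [starPart_mul_permRel hι]
    · rw [permPart_eq_zero h', mul_zero, starPart_eq_zero]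
      rintro ⟨o, σ, hσ⟩
      exact (exists_eq_permRel_of_mul_eq_starRel hι hσ).elim h h'

theorem starMatrix_one (hι : 4 ≤ Fintype.card ι) (t : R) :
    starMatrix t (1 : GenCorrespondence Prop ι) = 1 := by
  have : permPart R (permRel (Equiv.refl ι)) = 1 := by
    ext x y
    rw [permPart_permRel, Matrix.one_apply]
    rfl
  rw [← permRel_refl, starMatrix, starPart_permRel hι, this, Matrix.fromBlocks_one]

theorem starMatrix_mul (hι : 4 ≤ Fintype.card ι) (t : R) (m m' : GenCorrespondence Prop ι) :
    starMatrix t (m * m') = starMatrix t m * starMatrix t m' := by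
  simp [starMatrix, Matrix.fromBlocks_multiply, permPart_mul, starPart_mul hι]

theorem starMatrix_starRel_mulVec_inr (hι : 4 ≤ Fintype.card ι) (t : R) (x i : ι)
    (v : ι ⊕ ι → R) : (starMatrix t (starRel x (Equiv.refl ι))).mulVec v (Sum.inr i) =
      (if i = x then 1 else t) * v (Sum.inl i) := by
  have : Nontrivial ι := Fintype.one_lt_card_iff_nontrivial.1 (by omega)
  rw [starMatrix, permPart_eq_zero fun ⟨σ, h⟩ => permRel_ne_starRel _ _ _ h.symm]
  simp only [Matrix.mulVec, dotProduct, Fintype.sum_sum_type, Matrix.fromBlocks_apply₂₁,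
    Matrix.fromBlocks_apply₂₂, Matrix.zero_apply, zero_mul, Finset.sum_const_zero, add_zero,
    starPart_starRel hι, Equiv.refl_apply]
  rw [Finset.sum_eq_single i (fun y _ hy => by simp [hy.symm]) (by simp)]
  simp

theorem starMatrix_permRel_mulVec_inl (t : R) (σ : Equiv.Perm ι) (i : ι)
    (v : ι ⊕ ι → R) :
    (starMatrix t (permRel σ)).mulVec v (Sum.inl i) = v (Sum.inl (σ i)) := by
  simp [starMatrix, Matrix.mulVec, dotProduct, permPart_permRel]

theorem starMatrix_permRel_mulVec_inr (hι : 4 ≤ Fintype.card ι) (t : R) (σ : Equiv.Perm ι) (i : ι)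
    (v : ι ⊕ ι → R) :
    (starMatrix t (permRel σ)).mulVec v (Sum.inr i) = v (Sum.inr (σ i)) := by
  simp [starMatrix, Matrix.mulVec, dotProduct, permPart_permRel,
    starPart_permRel hι]

/-- A `k`-linear idempotent commuting with all matrices `starMatrix t m` is `0` or the identity,
if `t` is nilpotent and generates `R`, and `R` has no idempotents but `0` and `1`. -/
theorem eq_zero_or_eq_id_of_commute_starMatrix {k : Type*} [Field k] [Algebra k R]
    (hι : 4 ≤ Fintype.card ι) {t : R} (ht : IsNilpotent t) (hgen : Algebra.adjoin k {t} = ⊤)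
    (hR : ∀ c : R, c * c = c → c = 0 ∨ c = 1)
    (h : (ι ⊕ ι → R) →ₗ[k] (ι ⊕ ι → R))
    (hcomm : ∀ m v, h ((starMatrix t m).mulVec v) = (starMatrix t m).mulVec (h v))
    (hidem : ∀ v, h (h v) = h v) : (∀ v, h v = 0) ∨ ∀ v, h v = v := by
  have hstar : ∀ x j r, (starMatrix t (starRel x (Equiv.refl ι))).mulVec
      (Pi.single (Sum.inl j) r) = Pi.single (Sum.inr j) ((if j = x then 1 else t) * r) := by
    intro x j r
    ext (i | i)
    · rw [starMatrix_starRel_mulVec_inl hι]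
      simp
    · rw [starMatrix_starRel_mulVec_inr hι]
      by_cases hij : i = j
      · subst hij; simp
      · simp [hij]
  have hperm : ∀ (σ : Equiv.Perm ι) j r, (starMatrix t (permRel σ)).mulVec
      (Pi.single (Sum.inl (σ j)) r) = Pi.single (Sum.inl j) r := by
    intro σ j r
    ext (i | i)
    · rw [starMatrix_permRel_mulVec_inl]
      by_cases hij : i = j
      · subst hij; simp
      · simp [hij]
    · rw [starMatrix_permRel_mulVec_inr hι]
      simp
  have h12 : ∀ i j r, h (Pi.single (Sum.inr j) r) (Sum.inl i) = 0 := fun i j r => by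
    have := congrFun (hcomm (starRel j (Equiv.refl ι)) (Pi.single (Sum.inl j) r)) (Sum.inl i)
    rw [hstar, starMatrix_starRel_mulVec_inl hι] at this
    simpa using this
  -- With `G` and `H` the diagonal blocks of `h`, this is `H D_x = D_x G`.
  have hGH : ∀ x i j r, h (Pi.single (Sum.inr j) ((if j = x then 1 else t) * r)) (Sum.inr i) =
      (if i = x then 1 else t) * h (Pi.single (Sum.inl j) r) (Sum.inl i) := fun x i j r => by
    have := congrFun (hcomm (starRel x (Equiv.refl ι)) (Pi.single (Sum.inl j) r)) (Sum.inr i)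
    rwa [hstar, starMatrix_starRel_mulVec_inr hι] at this
  have hthird : ∀ i j : ι, ∃ x, x ≠ i ∧ x ≠ j := fun i j => by
    by_contra! hno
    have hsub : (Finset.univ : Finset ι) ⊆ {i, j} := fun x _ => by
      by_cases hx : x = i
      · simp [hx]
      · simp [hno x hx]
    have h1 := Finset.card_le_card hsub
    rw [Finset.card_univ] at h1
    have h2 := Finset.card_le_two (a := i) (b := j)
    omega
  -- Comparing `x = i` with a third point `x` gives `G_ij = t G_ij`, and `t` is nilpotent.
  have hG : ∀ i j r, i ≠ j → h (Pi.single (Sum.inl j) r) (Sum.inl i) = 0 := fun i j r hij => by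
    obtain ⟨x, hxi, hxj⟩ := hthird i j
    have h1 := hGH x i j r
    have h2 := hGH i i j r
    rw [if_neg hxi.symm, if_neg hxj.symm] at h1
    rw [if_neg hij.symm, if_pos rfl, one_mul, h1] at h2
    obtain ⟨n, hn⟩ := ht
    have h3 : ∀ n, h (Pi.single (Sum.inl j) r) (Sum.inl i) =
        t ^ n * h (Pi.single (Sum.inl j) r) (Sum.inl i) := fun n => by
      induction n with
      | zero => simp
      | succ n ih => rw [pow_succ, mul_assoc, h2, ← ih]
    rw [h3 n, hn, zero_mul]
  have hH : ∀ i j r, i ≠ j → h (Pi.single (Sum.inr j) r) (Sum.inr i) = 0 := fun i j r hij => by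
    have h1 := hGH j i j r
    rwa [if_pos rfl, one_mul, hG i j r hij, mul_zero] at h1
  have hdiag : ∀ i r, h (Pi.single (Sum.inr i) r) (Sum.inr i) =
      h (Pi.single (Sum.inl i) r) (Sum.inl i) := fun i r => by
    simpa using hGH i i i r
  have ht_comm : ∀ i r, h (Pi.single (Sum.inl i) (t * r)) (Sum.inl i) =
      t * h (Pi.single (Sum.inl i) r) (Sum.inl i) := fun i r => by
    obtain ⟨x, hxi, -⟩ := hthird i i
    rw [← hdiag]
    simpa [hxi.symm] using hGH x i i r
  have hlin : ∀ i s r, h (Pi.single (Sum.inl i) (s * r)) (Sum.inl i) =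
      s * h (Pi.single (Sum.inl i) r) (Sum.inl i) := fun i s => by
    have hs : s ∈ Algebra.adjoin k {t} := hgen ▸ Algebra.mem_top
    induction hs using Algebra.adjoin_induction with
    | mem s hs =>
      rw [Set.mem_singleton_iff] at hs
      subst hs
      exact ht_comm i
    | algebraMap c =>
      intro r
      rw [← Algebra.smul_def, ← Algebra.smul_def, Pi.single_smul, map_smul, Pi.smul_apply]
    | add s s' _ _ h1 h2 =>
      intro r
      rw [add_mul, add_mul, Pi.single_add, map_add, Pi.add_apply, h1, h2]
    | mul s s' _ _ h1 h2 =>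
      intro r
      rw [mul_assoc, mul_assoc, h1, h2]
  have hsame : ∀ i j r, h (Pi.single (Sum.inl i) r) (Sum.inl i) =
      h (Pi.single (Sum.inl j) r) (Sum.inl j) := fun i j r => by
    have := congrFun (hcomm (permRel (Equiv.swap i j))
      (Pi.single (Sum.inl (Equiv.swap i j i)) r)) (Sum.inl i)
    rw [hperm, starMatrix_permRel_mulVec_inl] at this
    simpa using this
  have : Nonempty ι := Fintype.card_pos_iff.1 (by omega)
  obtain ⟨o⟩ := this
  obtain ⟨c, hc⟩ : ∃ c, ∀ i r, h (Pi.single (Sum.inl i) r) (Sum.inl i) = c * r :=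
    ⟨h (Pi.single (Sum.inl o) 1) (Sum.inl o), fun i r => by
      rw [hsame i o, mul_comm _ r, ← hlin, mul_one]⟩
  have hsum : ∀ v p, h v p = ∑ q, h (Pi.single q (v q)) p := fun v p => by
    conv_lhs => rw [← Finset.univ_sum_single v]
    rw [map_sum, Finset.sum_apply]
  have hl : ∀ v i, h v (Sum.inl i) = c * v (Sum.inl i) := fun v i => by
    rw [hsum, Finset.sum_eq_single (Sum.inl i), hc]
    · rintro (j | j) - hj
      · exact hG i j _ fun hij => hj (by rw [hij])
      · exact h12 i j _
    · simp
  have hr : ∀ v, (∀ i, v (Sum.inl i) = 0) → ∀ i, h v (Sum.inr i) = c * v (Sum.inr i) :=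
    fun v hv i => by
    rw [hsum, Finset.sum_eq_single (Sum.inr i), hdiag, hc]
    · rintro (j | j) - hj
      · simp [hv j]
      · exact hH i j _ fun hij => hj (by rw [hij])
    · simp
  have hcc : c * c = c := by
    have := congrFun (hidem (Pi.single (Sum.inl o) 1)) (Sum.inl o)
    simpa [hl] using this
  rcases hR c hcc with rfl | rfl
  -- The image of `h` lies in the second summand, where `h` acts as `c = 0`; thus `h = h² = 0`.
  · left
    intro v
    rw [← hidem v]
    ext (i | i)
    · simp [hl]
    · rw [hr _ (fun j => by simp [hl])]
      simp
  -- The vector `v - h v` lies in the second summand, where `h` is the identity, yet `h` kills it.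
  · right
    intro v
    have h0 : h (v - h v) = 0 := by rw [map_sub, hidem, sub_self]
    have hv : ∀ i, (v - h v) (Sum.inl i) = 0 := fun i => by simp [hl]
    refine (sub_eq_zero.1 (funext fun p => ?_)).symm
    rcases p with i | i
    · exact hv i
    · have := hr _ hv i
      rw [h0, one_mul] at this
      exact this.symm

end Representation

end GenCorrespondence

/-! ### From trivial idempotents and distinct dimensions to infinite type -/

open CategoryTheory CategoryTheory.Limits in
theorem CategoryTheory.Indecomposable.of_idempotents {C : Type*} [Category C]
    [HasZeroMorphisms C] [HasBinaryBiproducts C] {M : C} (h0 : ¬ IsZero M)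
    (h : ∀ e : M ⟶ M, e ≫ e = e → e = 0 ∨ e = 𝟙 M) : Indecomposable M := by
  refine ⟨h0, fun Y Z i => ?_⟩
  rcases h (i.hom ≫ biprod.fst ≫ biprod.inl ≫ i.inv) (by simp) with he | he
  · left
    rw [IsZero.iff_id_eq_zero]
    calc 𝟙 Y = biprod.inl ≫ i.inv ≫ (i.hom ≫ biprod.fst ≫ biprod.inl ≫ i.inv) ≫ i.hom ≫
        biprod.fst := by simp
      _ = 0 := by rw [he]; simp
  · right
    rw [IsZero.iff_id_eq_zero]
    calc 𝟙 Z = biprod.inr ≫ i.inv ≫ 𝟙 M ≫ i.hom ≫ biprod.snd := by simp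
      _ = 0 := by rw [← he]; simp

theorem hasInfiniteRepresentationType_monoidAlgebra {k : Type u} {G : Type w} [Field k] [Monoid G]
    (V : ℕ → Type u) [∀ n, AddCommGroup (V n)] [∀ n, Module k (V n)]
    [∀ n, FiniteDimensional k (V n)] [∀ n, Nontrivial (V n)] (ρ : ∀ n, Representation k G (V n))
    (hdim : Function.Injective fun n => Module.finrank k (V n))
    (hidem : ∀ n (h : V n →ₗ[k] V n), (∀ g v, h (ρ n g v) = ρ n g (h v)) →
      (∀ v, h (h v) = h v) → (∀ v, h v = 0) ∨ ∀ v, h v = v) :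
    HasInfiniteRepresentationType k (MonoidAlgebra k G) := by
  intro hfin
  let M : ℕ → ModuleCat.{u} (MonoidAlgebra k G) := fun n => ModuleCat.of _ (ρ n).asModule
  have hind : ∀ n, CategoryTheory.Indecomposable (M n) := fun n => by
    apply CategoryTheory.Indecomposable.of_idempotents
    · intro h0
      have h1 : Subsingleton (M n) := ModuleCat.subsingleton_of_isZero h0
      have h2 : Nontrivial (V n) := inferInstance
      exact not_subsingleton (V n) h1
    · intro e he
      let h : V n →ₗ[k] V n :=
        { toFun := fun v => (ρ n).asModuleEquiv (e.hom ((ρ n).asModuleEquiv.symm v))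
          map_add' := fun v v' => by rw [map_add, map_add, map_add]
          map_smul' := fun c v => by
            rw [Representation.asModuleEquiv_symm_map_smul, map_smul,
              Representation.asModuleEquiv_map_smul, AlgHom.commutes]
            rfl }
      have hcomm : ∀ g v, h (ρ n g v) = ρ n g (h v) := fun g v => by
        change (ρ n).asModuleEquiv (e.hom ((ρ n).asModuleEquiv.symm (ρ n g v))) = _
        rw [Representation.asModuleEquiv_symm_map_rho, map_smul,
          Representation.asModuleEquiv_map_smul, Representation.asAlgebraHom_of]
        rfl
      have hi : ∀ v, h (h v) = h v := fun v => by
        have := congrArg (fun f => f.hom ((ρ n).asModuleEquiv.symm v)) he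
        exact this
      rcases hidem n h hcomm hi with h' | h'
      · left
        ext v
        exact h' v
      · right
        ext v
        exact h' v
  have hfd : ∀ n, FiniteDimensional k
      ((ModuleCat.restrictScalars (algebraMap k (MonoidAlgebra k G))).obj (M n)) := fun n =>
    Module.Finite.equiv (M := V n)
      { (ρ n).asModuleEquiv.symm.toAddEquiv with
        map_smul' := fun c v => (ρ n).asModuleEquiv_symm_map_smul c v }
  have hmem : ∀ n, Quotient.mk _ (M n) ∈ indecomposableClasses k (MonoidAlgebra k G) :=
    fun n => ⟨M n, hind n, hfd n, rfl⟩
  refine (Set.infinite_of_injective_forall_mem (f := fun n => Quotient.mk _ (M n)) ?_ hmem) hfin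
  intro m n hmn
  obtain ⟨i⟩ := Quotient.exact hmn
  let e : (ρ m).asModule ≃ₗ[MonoidAlgebra k G] (ρ n).asModule := i.toLinearEquiv
  let e' : V m ≃ₗ[k] V n :=
    (ρ m).asModuleEquiv.symm.trans ((e.restrictScalars k).trans (ρ n).asModuleEquiv)
  exact hdim e'.finrank_eq

/-! ### Truncated polynomial rings -/

section TruncatedPolynomials

open Polynomial

/-- The prime `X` cannot divide both `p` and `p - 1`, so `X ^ n ∣ p * (p - 1)` forces `X ^ n` to
divide one of them. -/
theorem AdjoinRoot.eq_zero_or_eq_one_of_mul_self_eq {k : Type*} [Field k] {n : ℕ}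
    {c : AdjoinRoot (X ^ n : k[X])} (hc : c * c = c) : c = 0 ∨ c = 1 := by
  induction c using AdjoinRoot.induction_on with | _ p => ?_
  have h : (X ^ n : k[X]) ∣ p * (p - 1) := by
    rw [← AdjoinRoot.mk_eq_zero, map_mul, map_sub, map_one, mul_sub, hc, mul_one, sub_self]
  by_cases hp : (X : k[X]) ∣ p
  · left
    rw [AdjoinRoot.mk_eq_zero]
    refine prime_X.pow_dvd_of_dvd_mul_right n (fun h1 => ?_) h
    have h2 : (X : k[X]) ∣ 1 := by simpa using dvd_sub hp h1
    exact prime_X.not_isUnit (isUnit_of_dvd_one h2)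
  · right
    rw [← sub_eq_zero, ← map_one (AdjoinRoot.mk _), ← map_sub, AdjoinRoot.mk_eq_zero]
    exact prime_X.pow_dvd_of_dvd_mul_left n hp h

theorem AdjoinRoot.isNilpotent_root_X_pow {k : Type*} [Field k] (n : ℕ) :
    IsNilpotent (AdjoinRoot.root (X ^ n : k[X])) :=
  ⟨n, by rw [← AdjoinRoot.mk_X, ← map_pow, AdjoinRoot.mk_self]⟩

end TruncatedPolynomials

/-! ### Reduction from `Λ` to relations, and conclusion -/

namespace GenCorrespondence

/-- A sup-prime element `a` of `Λ` and an enumeration of `X` turn `Λ`-generalized correspondences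
into relations, by `R ↦ (a ≤ R ·)`. -/
def toRel {Λ X ι : Type*} [DistribLattice Λ] [BoundedOrder Λ] [Fintype X] [DecidableEq X]
    [Fintype ι] [DecidableEq ι] {a : Λ} (ha : SupPrime a) (e : ι ≃ X) :
    GenCorrespondence Λ X →* GenCorrespondence Prop ι where
  toFun R := fun p => a ≤ R (e p.1, e p.2)
  map_one' := by
    ext x z
    change a ≤ (1 : GenCorrespondence Λ X) (e x, e z) ↔ (1 : GenCorrespondence Prop ι) (x, z)
    rw [one_apply, one_apply]
    by_cases h : x = z
    · simp [h]
    · simp [h, ha.ne_bot]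
  map_mul' R S := by
    ext x z
    refine Iff.trans ?_ (rel_mul_apply _ _ x z).symm
    change a ≤ (R * S) (e x, e z) ↔ ∃ y, a ≤ R (e x, e y) ∧ a ≤ S (e y, e z)
    rw [mul_apply]
    -- Sup-primeness extends to finite joins, turning the join over `y` into an existential.
    have key : ∀ (s : Finset X) (f : X → Λ), a ≤ s.sup f ↔ ∃ y ∈ s, a ≤ f y := fun s f => by
      classical
      induction s using Finset.induction_on with
      | empty => simp [ha.ne_bot]
      | insert b s _ ih => simp [Finset.sup_insert, ha.le_sup, ih]
    simp [key, e.surjective.exists]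

theorem toRel_surjective {Λ X ι : Type*} [DistribLattice Λ] [BoundedOrder Λ] [Fintype X]
    [DecidableEq X] [Fintype ι] [DecidableEq ι] {a : Λ} (ha : SupPrime a) (e : ι ≃ X) :
    Function.Surjective (toRel ha e) := fun R => by
  classical
  refine ⟨fun p => if R (e.symm p.1, e.symm p.2) then ⊤ else ⊥, ?_⟩
  ext x z
  change a ≤ (if R (e.symm (e x), e.symm (e z)) then ⊤ else ⊥) ↔ _
  by_cases h : R (x, z)
  · simp [h]
  · simp [h, ha.ne_bot]

/-- The representation of the monoid of relations given by `starMatrix t`. -/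
noncomputable def starRepresentation (k : Type*) {ι R : Type*} [Field k] [CommRing R]
    [Algebra k R] [Fintype ι] [DecidableEq ι] (hι : 4 ≤ Fintype.card ι) (t : R) :
    Representation k (GenCorrespondence Prop ι) (ι ⊕ ι → R) where
  toFun m := (starMatrix t m).mulVecLin.restrictScalars k
  map_one' := by
    refine LinearMap.ext fun v => ?_
    simp [starMatrix_one hι]
  map_mul' m m' := by
    refine LinearMap.ext fun v => ?_
    simp [starMatrix_mul hι, Matrix.mulVec_mulVec]

end GenCorrespondence

open Polynomial in
theorem mainTheorem2 (k : Type*) [Field k]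
    (Λ : Type*) [DistribLattice Λ] [BoundedOrder Λ] [Finite Λ] [Nontrivial Λ]
    (X : Type*) [Fintype X] [DecidableEq X] (hX : 4 ≤ Fintype.card X) :
    HasInfiniteRepresentationType k (MonoidAlgebra k (GenCorrespondence Λ X)) := by
  obtain ⟨a, ha⟩ : ∃ a : Λ, SupPrime a := by
    -- Sup-irreducibles are sup-prime by distributivity; one occurs in `⊤` because `⊤ ≠ ⊥`.
    obtain ⟨s, hs, hs'⟩ := exists_supIrred_decomposition (⊤ : Λ)
    obtain ⟨a, ha⟩ : s.Nonempty := by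
      rw [Finset.nonempty_iff_ne_empty]
      rintro rfl
      simp at hs
    exact ⟨a, (hs' ha).supPrime⟩
  -- Indexing by `Fin` instead of `X` keeps the modules in the universe of `k`.
  have hι : 4 ≤ Fintype.card (Fin (Fintype.card X)) := by simpa using hX
  let p := GenCorrespondence.toRel ha (Fintype.equivFin X).symm
  -- The exponent `n + 1` avoids the zero ring.
  let R : ℕ → Type _ := fun n => AdjoinRoot (Polynomial.X ^ (n + 1) : k[X])
  have hfin : ∀ n, FiniteDimensional k (R n) := fun n =>
    (AdjoinRoot.powerBasis' (monic_X_pow (n + 1))).finite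
  have hrank : ∀ n, Module.finrank k (R n) = n + 1 := fun n => by
    rw [(AdjoinRoot.powerBasis' (monic_X_pow (n + 1))).finrank, AdjoinRoot.powerBasis'_dim,
      natDegree_X_pow]
  have hdim : ∀ n, Module.finrank k (Fin (Fintype.card X) ⊕ Fin (Fintype.card X) → R n) =
      (Fintype.card X + Fintype.card X) * (n + 1) := fun n => by
    rw [Module.finrank_pi_fintype]
    simp [hrank]
  have hnon : ∀ n, Nontrivial (Fin (Fintype.card X) ⊕ Fin (Fintype.card X) → R n) := fun n =>
    Module.nontrivial_of_finrank_pos (R := k) (by rw [hdim]; positivity)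
  refine hasInfiniteRepresentationType_monoidAlgebra
    (fun n => Fin (Fintype.card X) ⊕ Fin (Fintype.card X) → R n)
    (fun n => (GenCorrespondence.starRepresentation k hι
      (AdjoinRoot.root (Polynomial.X ^ (n + 1) : k[X]))).comp p) ?_ ?_
  · intro m n hmn
    simp only [hdim] at hmn
    have := Nat.eq_of_mul_eq_mul_left (by omega) hmn
    omega
  · intro n h hcomm hidem
    refine GenCorrespondence.eq_zero_or_eq_id_of_commute_starMatrix hι
      (AdjoinRoot.isNilpotent_root_X_pow (n + 1)) AdjoinRoot.adjoinRoot_eq_top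
      (fun c => AdjoinRoot.eq_zero_or_eq_one_of_mul_self_eq) h (fun m v => ?_) hidem
    obtain ⟨g, rfl⟩ := GenCorrespondence.toRel_surjective ha (Fintype.equivFin X).symm m
    exact hcomm g v
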